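/- **Cost semirings.** Let $K=\langle K,+_K,\times_K,0_K,1_K\rangle$ be a commutative semiring that is absorptive ($a+_K(a\times_K b)=a$), ordered by $a\preceq b$ iff $a+_K b=b$ (so $1_K$ is the best and $0_K$ the worst cost), and invertible (whenever $b\preceq a$, the set $\{x\mid a\times_K x=b\}$ is non-empty and has a $\preceq$-minimum). The main example is the semiring of costs $K_c=\langle[0,\infty],\min,+,\infty,0\rangle$. We write costs additively, as in $K_c$: $a\oplus b:=a\times_K b$, $\mathbf 0:=1_K$, $a\le b:\iff b\preceq a$, and $\max(a,b)$ is the greatest lower bound of $a,b$ for $\preceq$ (rules that mention it apply when it exists). For $K_c$ these are the usual $+$, $0$, $\le$, $\max$ on $[0,\infty]$. **Formulas.** An extended modal label is a pair $a_b$ with $a,b\in K$. Labels are compared by $a_b\ge c_d$ iff $a\ge c$, and $a_b$ has price $a\oplus b$. Formulas are $$A::=p\mid \mathsf 0\mid \mathsf 1\mid A\multimap A\mid A\otimes A\mid A\,\&\,A\mid A\oplus A\mid\; !^{e}A\mid\; ¡^{e}A,$$ where $p$ is an atom and $e$ an extended label; $!$ is the permanent modality and $¡$ the single-use modality, with no restriction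 on polarity. $[F]_c$ is obtained from $F$ by replacing every modality $!^{a_b}$ by $!^{a_{b\oplus c}}$ (the modalities $¡$ are unchanged). $F$ is *$\multimap$-linear* if for every subformula $A\multimap B$ of $F$, the formula $A$ contains no modality $!$. **The labelled system.** Sequents are $\Gamma\Rightarrow_a C$ with $\Gamma$ a finite multiset of formulas and $a\in K$; $!\Gamma$ denotes a multiset of formulas of the form $!^{e}B$ (the labels may differ). The cut-free system $\mathrm{laSELL}_K$ has the following rules (premises / conclusion). - Axioms: $\Gamma,p\Rightarrow_{\mathbf 0}p$; $\ \Gamma\Rightarrow_{\mathbf 0}\mathsf 1$; $\ \Gamma,\mathsf 0\Rightarrow_{\mathbf 0}C$. - $\otimes_L$: $\Gamma,A,B\Rightarrow_b C\ /\ \Gamma,A\otimes B\Rightarrow_b C$. $\otimes_R$: $!\Gamma,\Delta_1\Rightarrow_a A$ and $!\Gamma,\Delta_2\Rightarrow_b B\ /\ !\Gamma,\Delta_1,\Delta_2\Rightarrow_{a\oplus b}A\otimes B$. - $\multimap_L$: $!\Gamma,\Delta_1\Rightarrow_a A$ and $!\Gamma,\Delta_2,B\Rightarrow_b C\ /\ !\Gamma,\Delta_1,\Delta_2,A\multimap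 B\Rightarrow_{a\oplus b}C$. $\multimap_R$: $\Gamma,A\Rightarrow_b B\ /\ \Gamma\Rightarrow_b A\multimap B$. - $\&_{L_i}$: $\Gamma,A_i\Rightarrow_b C\ /\ \Gamma,A_1\& A_2\Rightarrow_b C$. $\&_R$: $\Gamma\Rightarrow_a A$ and $\Gamma\Rightarrow_b B\ /\ \Gamma\Rightarrow_{\max(a,b)}A\& B$. - $\oplus_L$: $\Gamma,A\Rightarrow_a C$ and $\Gamma,B\Rightarrow_b C\ /\ \Gamma,A\oplus B\Rightarrow_{\max(a,b)}C$. $\oplus_{R_i}$: $\Gamma\Rightarrow_b A_i\ /\ \Gamma\Rightarrow_b A_1\oplus A_2$. - Dereliction, for a label $e$ of price $r$: $\Gamma,!^{e}A,A\Rightarrow_c C\ /\ \Gamma,!^{e}A\Rightarrow_{c\oplus r}C$, and $\Gamma,A\Rightarrow_c C\ /\ \Gamma,¡^{e}A\Rightarrow_{c\oplus r}C$. - Promotion: $\Gamma^{\le !^e}\Rightarrow_b A\ /\ \Gamma\Rightarrow_b\,!^{e}A$, and $\Gamma^{\le ¡^e}\Rightarrow_b A\ /\ \Gamma\Rightarrow_b\,¡^{e}A$,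 where $\Gamma^{\le !^e}$ consists of all formulas of $\Gamma$ of the form $!^{f}B$ with $e\ge f$, and $\Gamma^{\le ¡^e}$ of all formulas of $\Gamma$ of the form $!^{f}B$ or $¡^{f}B$ with $e\ge f$. - Label weakening: $\Gamma\Rightarrow_a A\ /\ \Gamma\Rightarrow_b A$ whenever $b\ge a$. **Theorem ($\multimap$-linear cut).** The following rule $cut_{LL}$ is admissible in $\mathrm{laSELL}_K$: for every $\multimap$-linear formula $F$, $$\frac{!\Gamma,\Delta_1\Rightarrow_a F\qquad !\Gamma,\Delta_2,[F]_a\Rightarrow_b C}{!\Gamma,\Delta_1,\Delta_2\Rightarrow_{a\oplus b}C}.$$ That is, if both premises have cut-free proofs, so does the conclusion. Moreover, if $\Gamma\Rightarrow_a C$ is provable in $\mathrm{laSELL}_K$ extended by $cut_{LL}$ (used any number of times), then there is a cut-free proof of $\Gamma\Rightarrow_{a'}C$ for some $a'\le a$. For $K=K_c$ the label of the conclusion of $cut_{LL}$ is the sum $a+b$. -/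

import Mathlib

namespace LaSELL

/-! ### Cost semirings -/

/-- The order of an absorptive semiring: `a ⪯ b` iff `a + b = b`. The larger element is the better
(cheaper) cost; `0` is the worst and `1` the best cost. -/
def CostLE {K : Type*} [CommSemiring K] (a b : K) : Prop := a + b = b

/-- `c` is the greatest lower bound of `a` and `b` with respect to `⪯`. -/
def IsCostGlb {K : Type*} [CommSemiring K] (a b c : K) : Prop :=
  CostLE c a ∧ CostLE c b ∧ ∀ d, CostLE d a → CostLE d b → CostLE d c

/-- Absorptive commutative semirings: `a + a × b = a`. -/
class Absorptive (K : Type*) [CommSemiring K] : Prop where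
  absorb : ∀ a b : K, a + a * b = a

/-- Invertible commutative semirings: for `b ⪯ a` the set `{x | a × x = b}` is non-empty and has a
minimum with respect to `⪯`. -/
class Invertible (K : Type*) [CommSemiring K] : Prop where
  exists_min : ∀ a b : K, CostLE b a →
    ∃ m : K, a * m = b ∧ ∀ x : K, a * x = b → CostLE m x

/-! The semiring of costs `⟨[0,∞], min, +, ∞, 0⟩` is `Tropical ℝ≥0∞`; it is absorptive and
invertible, `×` is the addition of `[0,∞]`, and `⪯` is the order `≥` of `[0,∞]`. -/

theorem tropical_costLE_iff (a b : Tropical ENNReal) :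
    CostLE a b ↔ Tropical.untrop b ≤ Tropical.untrop a := by
  unfold CostLE
  rw [Tropical.add_eq_right_iff, Tropical.untrop_le_iff]

theorem tropical_glb (a b : Tropical ENNReal) :
    IsCostGlb a b (Tropical.trop (max (Tropical.untrop a) (Tropical.untrop b))) := by
  simp only [IsCostGlb, tropical_costLE_iff, Tropical.untrop_trop]
  exact ⟨le_max_left _ _, le_max_right _ _, fun d h₁ h₂ => max_le h₁ h₂⟩

instance : Absorptive (Tropical ENNReal) where
  absorb a b := by
    rw [Tropical.add_eq_left_iff, ← Tropical.untrop_le_iff, Tropical.untrop_mul]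
    exact le_self_add

instance : Invertible (Tropical ENNReal) where
  exists_min a b h := by
    rw [tropical_costLE_iff] at h
    refine ⟨if Tropical.untrop b = ⊤ then Tropical.trop ⊤
      else Tropical.trop (Tropical.untrop b - Tropical.untrop a), ?_, ?_⟩
    · apply Tropical.untrop_injective
      rw [Tropical.untrop_mul]
      split_ifs with hb
      · simp [hb]
      · exact add_tsub_cancel_of_le h
    · intro x hx
      rw [tropical_costLE_iff]
      have hx' : Tropical.untrop a + Tropical.untrop x = Tropical.untrop b := by
        rw [← hx, Tropical.untrop_mul]
      split_ifs with hb
      · simp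
      · rw [Tropical.untrop_trop]
        have ha : Tropical.untrop a ≠ ⊤ := fun ha => hb (by rw [← hx', ha, top_add])
        rw [← hx', ENNReal.add_sub_cancel_left ha]

/-! ### Formulas with extended modal labels -/

/-- The extended modal label `a_b`, with base `a` and extra cost `b`. -/
structure ModalLabel (K : Type*) where
  base : K
  extra : K

/-- The total price `a × b` of a dereliction of a modality with label `a_b`
(for costs in `[0,∞]` this is `a + b`). -/
def ModalLabel.price {K : Type*} [CommSemiring K] (e : ModalLabel K) : K := e.base * e.extra

/-- The order on extended modal labels compares the bases only. -/
def ModalLabel.le {K : Type*} [CommSemiring K] (e f : ModalLabel K) : Prop :=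
  CostLE e.base f.base

/-- Formulas over the atoms `α`; `bang` is the permanent (unbounded) modality `!` and `vbang` is
the single-use (bounded) modality. -/
inductive Formula (α K : Type*) where
  | atom (p : α)
  | zero
  | one
  | lolli (A B : Formula α K)
  | tensor (A B : Formula α K)
  | with_ (A B : Formula α K)
  | plus (A B : Formula α K)
  | bang (e : ModalLabel K) (A : Formula α K)
  | vbang (e : ModalLabel K) (A : Formula α K)

namespace Formula

variable {α K : Type*}

/-- The set of subformulas of a formula, including the formula itself. -/
def subformulas : Formula α K → Set (Formula α K)
  | atom p => {atom p}
  | zero => {zero}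
  | one => {one}
  | lolli A B => {lolli A B} ∪ A.subformulas ∪ B.subformulas
  | tensor A B => {tensor A B} ∪ A.subformulas ∪ B.subformulas
  | with_ A B => {with_ A B} ∪ A.subformulas ∪ B.subformulas
  | plus A B => {plus A B} ∪ A.subformulas ∪ B.subformulas
  | bang e A => {bang e A} ∪ A.subformulas
  | vbang e A => {vbang e A} ∪ A.subformulas

/-- No occurrence of the modality `!`; the single-use modality may occur. -/
def BangFree (F : Formula α K) : Prop := ∀ e A, bang e A ∉ F.subformulas

/-- `⊸`-linear formulas: `A` is `!`-free for every subformula `A ⊸ B`. -/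
def LolliLinear (F : Formula α K) : Prop := ∀ A B, lolli A B ∈ F.subformulas → A.BangFree

/-- The formula is of the form `!B`. -/
def IsBang (F : Formula α K) : Prop := ∃ e B, F = bang e B

/-- `[F]_c`: every modality `!` with label `a_b` gets the label `a_(b × c)`
(for costs in `[0,∞]` this is `a_(b + c)`). -/
def charge [CommSemiring K] (c : K) : Formula α K → Formula α K
  | atom p => atom p
  | zero => zero
  | one => one
  | lolli A B => lolli (A.charge c) (B.charge c)
  | tensor A B => tensor (A.charge c) (B.charge c)
  | with_ A B => with_ (A.charge c) (B.charge c)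
  | plus A B => plus (A.charge c) (B.charge c)
  | bang e A => bang ⟨e.base, e.extra * c⟩ (A.charge c)
  | vbang e A => vbang e (A.charge c)

/-- The formulas that survive a promotion of `!` with label `e`. -/
def BelowBang [CommSemiring K] (e : ModalLabel K) (F : Formula α K) : Prop :=
  ∃ f B, e.le f ∧ F = bang f B

/-- The formulas that survive a promotion of the single-use modality with label `e`. -/
def BelowVbang [CommSemiring K] (e : ModalLabel K) (F : Formula α K) : Prop :=
  ∃ f B, e.le f ∧ (F = bang f B ∨ F = vbang f B)

end Formula

/-! ### The labelled sequent system -/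

open Classical in
/-- The part of a context that survives a promotion of `!` with label `e`. -/
noncomputable def restrictBang {α K : Type*} [CommSemiring K] (e : ModalLabel K)
    (Γ : Multiset (Formula α K)) : Multiset (Formula α K) :=
  Γ.filter (Formula.BelowBang e)

open Classical in
/-- The part of a context that survives a promotion of the single-use modality with label `e`. -/
noncomputable def restrictVbang {α K : Type*} [CommSemiring K] (e : ModalLabel K)
    (Γ : Multiset (Formula α K)) : Multiset (Formula α K) :=
  Γ.filter (Formula.BelowVbang e)

/-- The system without cut, and its extension by the `⊸`-linear cut rule. -/
inductive Mode where
  | cutFree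
  | withCut

open Formula in
/-- `Derivable m Γ a C`: the labelled sequent `Γ ⇒_a C` has a proof, which may use the
`⊸`-linear cut rule only if `m = Mode.withCut`. -/
inductive Derivable {α K : Type*} [CommSemiring K] (m : Mode) :
    Multiset (Formula α K) → K → Formula α K → Prop where
  | init (Γ : Multiset (Formula α K)) (p : α) : Derivable m (atom p ::ₘ Γ) 1 (atom p)
  | oneR (Γ : Multiset (Formula α K)) : Derivable m Γ 1 one
  | zeroL (Γ : Multiset (Formula α K)) (C : Formula α K) : Derivable m (zero ::ₘ Γ) 1 C
  | tensorL {Γ : Multiset (Formula α K)} {A B C : Formula α K} {b : K} :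
      Derivable m (A ::ₘ B ::ₘ Γ) b C → Derivable m (tensor A B ::ₘ Γ) b C
  | tensorR {Γ Δ₁ Δ₂ : Multiset (Formula α K)} {A B : Formula α K} {a b : K} :
      (∀ G ∈ Γ, G.IsBang) →
      Derivable m (Γ + Δ₁) a A → Derivable m (Γ + Δ₂) b B →
      Derivable m (Γ + Δ₁ + Δ₂) (a * b) (tensor A B)
  | lolliL {Γ Δ₁ Δ₂ : Multiset (Formula α K)} {A B C : Formula α K} {a b : K} :
      (∀ G ∈ Γ, G.IsBang) →
      Derivable m (Γ + Δ₁) a A → Derivable m (B ::ₘ (Γ + Δ₂)) b C →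
      Derivable m (lolli A B ::ₘ (Γ + Δ₁ + Δ₂)) (a * b) C
  | lolliR {Γ : Multiset (Formula α K)} {A B : Formula α K} {b : K} :
      Derivable m (A ::ₘ Γ) b B → Derivable m Γ b (lolli A B)
  | withL₁ {Γ : Multiset (Formula α K)} {A B C : Formula α K} {b : K} :
      Derivable m (A ::ₘ Γ) b C → Derivable m (with_ A B ::ₘ Γ) b C
  | withL₂ {Γ : Multiset (Formula α K)} {A B C : Formula α K} {b : K} :
      Derivable m (B ::ₘ Γ) b C → Derivable m (with_ A B ::ₘ Γ) b C
  | withR {Γ : Multiset (Formula α K)} {A B : Formula α K} {a b c : K} :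
      IsCostGlb a b c → Derivable m Γ a A → Derivable m Γ b B → Derivable m Γ c (with_ A B)
  | plusL {Γ : Multiset (Formula α K)} {A B C : Formula α K} {a b c : K} :
      IsCostGlb a b c → Derivable m (A ::ₘ Γ) a C → Derivable m (B ::ₘ Γ) b C →
      Derivable m (plus A B ::ₘ Γ) c C
  | plusR₁ {Γ : Multiset (Formula α K)} {A B : Formula α K} {b : K} :
      Derivable m Γ b A → Derivable m Γ b (plus A B)
  | plusR₂ {Γ : Multiset (Formula α K)} {A B : Formula α K} {b : K} :
      Derivable m Γ b B → Derivable m Γ b (plus A B)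
  | bangL {Γ : Multiset (Formula α K)} {e : ModalLabel K} {A C : Formula α K} {c : K} :
      Derivable m (A ::ₘ bang e A ::ₘ Γ) c C →
      Derivable m (bang e A ::ₘ Γ) (c * e.price) C
  | vbangL {Γ : Multiset (Formula α K)} {e : ModalLabel K} {A C : Formula α K} {c : K} :
      Derivable m (A ::ₘ Γ) c C → Derivable m (vbang e A ::ₘ Γ) (c * e.price) C
  | bangR {Γ : Multiset (Formula α K)} {e : ModalLabel K} {A : Formula α K} {b : K} :
      Derivable m (restrictBang e Γ) b A → Derivable m Γ b (bang e A)
  | vbangR {Γ : Multiset (Formula α K)} {e : ModalLabel K} {A : Formula α K} {b : K} :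
      Derivable m (restrictVbang e Γ) b A → Derivable m Γ b (vbang e A)
  | weakenLabel {Γ : Multiset (Formula α K)} {A : Formula α K} {a b : K} :
      CostLE b a → Derivable m Γ a A → Derivable m Γ b A
  | cut {Γ Δ₁ Δ₂ : Multiset (Formula α K)} {F C : Formula α K} {a b : K} :
      m = Mode.withCut → F.LolliLinear → (∀ G ∈ Γ, G.IsBang) →
      Derivable m (Γ + Δ₁) a F → Derivable m (F.charge a ::ₘ (Γ + Δ₂)) b C →
      Derivable m (Γ + Δ₁ + Δ₂) (a * b) C

end LaSELL

namespace LaSELL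

open Formula

/-! ### The order of costs -/

/-! The cut is eliminated by induction on the size of the cut formula and, inside it, on the left
proof. A left proof ending in a left rule lets the cut move up into a premise proving `F`, whose
label is at least as cheap; since the right premise contains `F` charged with the label of the left
one, the charge must be lowered too, which `Derivable.charge_mono` permits.

When the left proof introduces `F` on the right, its context `Γ` is substituted for `F` throughout
the right proof (`Derivable.substitute`). The predicate `Replaces` states what is needed wherever
`F` is principal there, and it follows from cuts on the immediate subformulas. A formula that is not
of the form `!B` is used at most once on each branch, so the left label `a` is paid once, as the
factor `a` of the conclusion. A formula `!B` may be derelicted many times, but the charge has put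
`a` into the price of each dereliction, so every copy pays for itself and the substitution adds no
cost.

Linearity matters for `A ⊸ B`: there the right proof supplies `A.charge a` while the left proof
consumes `A`. The two coincide when `A` is `!`-free.

Shared `!`-contexts are duplicated along the way and merged again by `Derivable.contract`. Label
weakening allows all bounds to be met exactly, so eliminating cuts does not change the label of the
end sequent. -/

theorem CostLE.refl {K : Type*} [CommSemiring K] [Absorptive K] (a : K) : CostLE a a := by
  simpa [CostLE] using Absorptive.absorb a 1

theorem CostLE.trans {K : Type*} [CommSemiring K] {a b c : K} (h₁ : CostLE a b)
    (h₂ : CostLE b c) : CostLE a c := by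
  unfold CostLE at *
  rw [← h₂, ← add_assoc, h₁]

theorem CostLE.mul_left {K : Type*} [CommSemiring K] [Absorptive K] (a b : K) :
    CostLE (a * b) a := by
  unfold CostLE
  rw [add_comm]
  exact Absorptive.absorb a b

theorem CostLE.mul_right {K : Type*} [CommSemiring K] [Absorptive K] (a b : K) :
    CostLE (a * b) b := by
  rw [mul_comm]
  exact CostLE.mul_left b a

theorem CostLE.one {K : Type*} [CommSemiring K] [Absorptive K] (a : K) : CostLE a 1 := by
  simpa using CostLE.mul_left 1 a

theorem CostLE.mul {K : Type*} [CommSemiring K] {a b : K} (c : K) (h : CostLE a b) :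
    CostLE (c * a) (c * b) := by
  unfold CostLE at *
  rw [← mul_add, h]

/-- Greatest lower bounds need not exist in general, but this one always does. After weakening both
premises to one label, the additive rules therefore apply without any question of existence. -/
theorem IsCostGlb.self {K : Type*} [CommSemiring K] [Absorptive K] (a : K) :
    IsCostGlb a a a :=
  ⟨CostLE.refl a, CostLE.refl a, fun _ h _ => h⟩

/-! ### Classes of formulas -/

namespace Formula

variable {α K : Type*}

theorem mem_subformulas_self (F : Formula α K) : F ∈ F.subformulas := by
  cases F <;> simp [subformulas]

theorem LolliLinear.mono {F G : Formula α K} (h : F.LolliLinear)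
    (hG : G.subformulas ⊆ F.subformulas) : G.LolliLinear :=
  fun A B hAB => h A B (hG hAB)

theorem BangFree.mono {F G : Formula α K} (h : F.BangFree)
    (hG : G.subformulas ⊆ F.subformulas) : G.BangFree :=
  fun e A hA => h e A (hG hA)

/-- Charging touches only the labels of `!`. This is the sole point at which `⊸`-linearity enters
cut elimination. -/
theorem BangFree.charge_eq [CommSemiring K] (c : K) {F : Formula α K} (h : F.BangFree) :
    F.charge c = F := by
  induction F with
  | atom | zero | one => rfl
  | lolli A B ihA ihB | tensor A B ihA ihB | with_ A B ihA ihB | plus A B ihA ihB =>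
    simp only [charge]
    rw [ihA (h.mono fun x hx => by simp [subformulas, hx]),
      ihB (h.mono fun x hx => by simp [subformulas, hx])]
  | bang e A => exact absurd (mem_subformulas_self _) (h e A)
  | vbang e A ih =>
    simp only [charge]
    rw [ih (h.mono fun x hx => by simp [subformulas, hx])]

/-- `Cheaper F G`: the formulas agree except that the extra costs of the modalities `!` of `G` are
at least as good as those of `F`. -/
inductive Cheaper [CommSemiring K] : Formula α K → Formula α K → Prop
  | atom (p : α) : Cheaper (atom p) (atom p)
  | zero : Cheaper zero zero
  | one : Cheaper one one
  | lolli {A B A' B' : Formula α K} :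
      Cheaper A A' → Cheaper B B' → Cheaper (lolli A B) (lolli A' B')
  | tensor {A B A' B' : Formula α K} :
      Cheaper A A' → Cheaper B B' → Cheaper (tensor A B) (tensor A' B')
  | with_ {A B A' B' : Formula α K} :
      Cheaper A A' → Cheaper B B' → Cheaper (with_ A B) (with_ A' B')
  | plus {A B A' B' : Formula α K} :
      Cheaper A A' → Cheaper B B' → Cheaper (plus A B) (plus A' B')
  | bang {r c c' : K} {A A' : Formula α K} :
      CostLE c c' → Cheaper A A' → Cheaper (bang ⟨r, c⟩ A) (bang ⟨r, c'⟩ A')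
  | vbang {e : ModalLabel K} {A A' : Formula α K} :
      Cheaper A A' → Cheaper (vbang e A) (vbang e A')

theorem Cheaper.refl [CommSemiring K] [Absorptive K] (F : Formula α K) : Cheaper F F := by
  induction F with
  | bang e A ih => exact .bang (CostLE.refl _) ih
  | _ => constructor <;> assumption

theorem Cheaper.charge [CommSemiring K] [Absorptive K] {a b : K} (h : CostLE a b)
    (F : Formula α K) : Cheaper (F.charge a) (F.charge b) := by
  induction F with
  | bang e A ih => exact .bang (CostLE.mul _ h) ih
  | _ => constructor <;> assumption

theorem Cheaper.isBang_iff [CommSemiring K] {F G : Formula α K} (h : Cheaper F G) :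
    F.IsBang ↔ G.IsBang := by
  cases h <;> simp [IsBang]

/-- Promotion compares only the bases of labels, while `Cheaper` alters only extra costs. -/
theorem Cheaper.belowBang_iff [CommSemiring K] {F G : Formula α K} (h : Cheaper F G)
    (e : ModalLabel K) : F.BelowBang e ↔ G.BelowBang e := by
  cases h <;> simp [BelowBang, ModalLabel.le]

theorem Cheaper.belowVbang_iff [CommSemiring K] {F G : Formula α K} (h : Cheaper F G)
    (e : ModalLabel K) : F.BelowVbang e ↔ G.BelowVbang e := by
  cases h <;> simp [BelowVbang, ModalLabel.le]

theorem BelowBang.isBang [CommSemiring K] {e : ModalLabel K} {F : Formula α K}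
    (h : F.BelowBang e) : F.IsBang := by
  obtain ⟨f, B, -, h⟩ := h
  exact ⟨f, B, h⟩

theorem BelowBang.trans [CommSemiring K] {e f : ModalLabel K} {F : Formula α K}
    (h : F.BelowBang f) (hef : e.le f) : F.BelowBang e := by
  obtain ⟨g, B, hg, h⟩ := h
  exact ⟨g, B, CostLE.trans hef hg, h⟩

theorem BelowVbang.trans [CommSemiring K] {e f : ModalLabel K} {F : Formula α K}
    (h : F.BelowVbang f) (hef : e.le f) : F.BelowVbang e := by
  obtain ⟨g, B, hg, h⟩ := h
  exact ⟨g, B, CostLE.trans hef hg, h⟩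

theorem BelowBang.belowVbang [CommSemiring K] {e : ModalLabel K} {F : Formula α K}
    (h : F.BelowBang e) : F.BelowVbang e := by
  obtain ⟨g, B, hg, h⟩ := h
  exact ⟨g, B, hg, Or.inl h⟩

end Formula

/-! ### Weakening and contraction -/

open Classical in
/-- `Γ` can be turned into `Δ` by weakening and by contraction of formulas `!B`. -/
def ContextLE {α K : Type*} (Γ Δ : Multiset (Formula α K)) : Prop :=
  (∀ H : Formula α K, ¬ H.IsBang → Γ.count H ≤ Δ.count H) ∧ ∀ H ∈ Γ, H.IsBang → H ∈ Δ

namespace ContextLE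

variable {α K : Type*} {Γ Δ Θ : Multiset (Formula α K)} {F : Formula α K}

theorem of_le (h : Γ ≤ Δ) : ContextLE Γ Δ :=
  ⟨fun H _ => by classical exact Multiset.count_le_of_le H h, fun _ hH _ => Multiset.mem_of_le h hH⟩

theorem cons (F : Formula α K) (h : ContextLE Γ Δ) : ContextLE (F ::ₘ Γ) (F ::ₘ Δ) := by
  classical
  refine ⟨fun H hH => ?_, fun H hH hb => ?_⟩
  · have := h.1 H hH
    simp only [Multiset.count_cons]
    omega
  · rw [Multiset.mem_cons] at hH ⊢
    exact hH.imp id fun hH => h.2 H hH hb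

theorem filter (p : Formula α K → Prop) [DecidablePred p] (h : ContextLE Γ Δ) :
    ContextLE (Γ.filter p) (Δ.filter p) := by
  classical
  refine ⟨fun H hH => ?_, fun H hH hb => ?_⟩
  · have := h.1 H hH
    simp only [Multiset.count_filter]
    split_ifs <;> omega
  · rw [Multiset.mem_filter] at hH ⊢
    exact ⟨h.2 H hH.1 hb, hH.2⟩

theorem mem (h : ContextLE Γ Δ) (hF : F ∈ Γ) : F ∈ Δ := by
  classical
  by_cases hb : F.IsBang
  · exact h.2 F hF hb
  · rw [← Multiset.one_le_count_iff_mem] at hF ⊢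
    exact hF.trans (h.1 F hb)

/-- Multiplicities of formulas that are not `!B` are respected, so one occurrence can be removed on
both sides. This recovers the principal formula of a left rule in the larger context. -/
theorem exists_cons (hF : ¬ F.IsBang) (h : ContextLE (F ::ₘ Γ) Δ) :
    ∃ Δ', Δ = F ::ₘ Δ' ∧ ContextLE Γ Δ' := by
  classical
  obtain ⟨Δ', rfl⟩ := Multiset.exists_cons_of_mem (h.mem (Multiset.mem_cons_self F Γ))
  refine ⟨Δ', rfl, fun H hH => ?_, fun H hH hb => ?_⟩
  · have := h.1 H hH
    simp only [Multiset.count_cons] at this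
    omega
  · have := h.2 H (Multiset.mem_cons_of_mem hH) hb
    rw [Multiset.mem_cons] at this
    rcases this with rfl | this
    · exact absurd hb hF
    · exact this

theorem exists_split {Δ₁ Δ₂ : Multiset (Formula α K)} (hΓ : ∀ G ∈ Γ, G.IsBang)
    (h : ContextLE (Γ + Δ₁ + Δ₂) Θ) :
    ∃ Γ' Δ₁' Δ₂', Θ = Γ' + Δ₁' + Δ₂' ∧ (∀ G ∈ Γ', G.IsBang) ∧
      ContextLE (Γ + Δ₁) (Γ' + Δ₁') ∧ ContextLE (Γ + Δ₂) (Γ' + Δ₂') := by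
  classical
  have hle : Δ₂.filter (fun H => ¬ H.IsBang) ≤ Θ.filter (fun H => ¬ H.IsBang) := by
    rw [Multiset.le_iff_count]
    intro H
    simp only [Multiset.count_filter]
    by_cases hH : H.IsBang
    · simp [hH]
    · have := h.1 H hH
      simp only [Multiset.count_add, hH, not_false_eq_true, if_true] at this ⊢
      omega
  have hcount : ∀ H : Formula α K, ¬ H.IsBang → Γ.count H = 0 := fun H hH =>
    Multiset.count_eq_zero.2 fun hm => hH (hΓ H hm)
  -- All formulas `!B` of `Θ` become shared; of the others, the second part receives exactly those
  -- of `Δ₂`, and the first part all the surplus.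
  refine ⟨Θ.filter IsBang, Θ.filter (fun H => ¬ H.IsBang) - Δ₂.filter (fun H => ¬ H.IsBang),
    Δ₂.filter (fun H => ¬ H.IsBang), ?_, fun G hG => (Multiset.mem_filter.1 hG).2,
    ⟨fun H hH => ?_, fun H hm hH => ?_⟩, ⟨fun H hH => ?_, fun H hm hH => ?_⟩⟩
  · rw [add_assoc, tsub_add_cancel_of_le hle, Multiset.filter_add_not]
  · have := h.1 H hH
    simp only [Multiset.count_add, Multiset.count_sub, Multiset.count_filter, hH, hcount H hH,
      not_false_eq_true, if_true, if_false] at this ⊢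
    omega
  · refine Multiset.mem_add.2 (Or.inl (Multiset.mem_filter.2 ⟨h.2 H ?_ hH, hH⟩))
    exact Multiset.mem_add.2 (Or.inl hm)
  · simp [hH, hcount H hH]
  · refine Multiset.mem_add.2 (Or.inl (Multiset.mem_filter.2 ⟨h.2 H ?_ hH, hH⟩))
    simp only [Multiset.mem_add] at hm ⊢
    tauto

end ContextLE

namespace Derivable

variable {α K : Type*} [CommSemiring K] {Γ Δ : Multiset (Formula α K)} {C : Formula α K} {a : K}

/-- Weakening and contraction are proved in one induction: axioms absorb extra formulas, dereliction
of `!` keeps its principal formula, and the two-premise multiplicative rules share all formulas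
`!B`. Labels stay the same. -/
theorem of_contextLE (h : Derivable Mode.cutFree Γ a C) (hΓ : ContextLE Γ Δ) :
    Derivable Mode.cutFree Δ a C := by
  classical
  induction h generalizing Δ with
  | init Γ p =>
    obtain ⟨Δ', rfl, -⟩ := hΓ.exists_cons (by simp [IsBang])
    exact .init Δ' p
  | oneR => exact .oneR Δ
  | zeroL Γ C =>
    obtain ⟨Δ', rfl, -⟩ := hΓ.exists_cons (by simp [IsBang])
    exact .zeroL Δ' C
  | tensorL _ ih =>
    obtain ⟨Δ', rfl, h'⟩ := hΓ.exists_cons (by simp [IsBang])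
    exact .tensorL (ih ((h'.cons _).cons _))
  | tensorR hb _ _ ih₁ ih₂ =>
    obtain ⟨Γ', Δ₁', Δ₂', rfl, hb', h₁, h₂⟩ := hΓ.exists_split hb
    exact .tensorR hb' (ih₁ h₁) (ih₂ h₂)
  | lolliL hb _ _ ih₁ ih₂ =>
    obtain ⟨Δ', rfl, h'⟩ := hΓ.exists_cons (by simp [IsBang])
    obtain ⟨Γ', Δ₁', Δ₂', rfl, hb', h₁, h₂⟩ := h'.exists_split hb
    exact .lolliL hb' (ih₁ h₁) (ih₂ (h₂.cons _))
  | lolliR _ ih => exact .lolliR (ih (hΓ.cons _))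
  | withL₁ _ ih =>
    obtain ⟨Δ', rfl, h'⟩ := hΓ.exists_cons (by simp [IsBang])
    exact .withL₁ (ih (h'.cons _))
  | withL₂ _ ih =>
    obtain ⟨Δ', rfl, h'⟩ := hΓ.exists_cons (by simp [IsBang])
    exact .withL₂ (ih (h'.cons _))
  | withR hg _ _ ih₁ ih₂ => exact .withR hg (ih₁ hΓ) (ih₂ hΓ)
  | plusL hg _ _ ih₁ ih₂ =>
    obtain ⟨Δ', rfl, h'⟩ := hΓ.exists_cons (by simp [IsBang])
    exact .plusL hg (ih₁ (h'.cons _)) (ih₂ (h'.cons _))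
  | plusR₁ _ ih => exact .plusR₁ (ih hΓ)
  | plusR₂ _ ih => exact .plusR₂ (ih hΓ)
  | bangL _ ih =>
    -- Membership suffices for `!`: its principal formula stays in the premise, so no occurrence has
    -- to be removed.
    obtain ⟨Δ', rfl⟩ := Multiset.exists_cons_of_mem (hΓ.mem (Multiset.mem_cons_self _ _))
    exact .bangL (ih (hΓ.cons _))
  | vbangL _ ih =>
    obtain ⟨Δ', rfl, h'⟩ := hΓ.exists_cons (by simp [IsBang])
    exact .vbangL (ih (h'.cons _))
  | bangR _ ih => exact .bangR (ih (hΓ.filter _))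
  | vbangR _ ih => exact .vbangR (ih (hΓ.filter _))
  | weakenLabel hl _ ih => exact .weakenLabel hl (ih hΓ)
  | cut hm => cases hm

theorem of_le (h : Derivable Mode.cutFree Γ a C) (hΓ : Γ ≤ Δ) : Derivable Mode.cutFree Δ a C :=
  h.of_contextLE (.of_le hΓ)

theorem contract (hΓ : ∀ G ∈ Γ, G.IsBang) (h : Derivable Mode.cutFree (Γ + (Γ + Δ)) a C) :
    Derivable Mode.cutFree (Γ + Δ) a C := by
  classical
  refine h.of_contextLE ⟨fun H hH => ?_, fun H hm _ => ?_⟩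
  · have : Γ.count H = 0 := Multiset.count_eq_zero.2 fun hm => hH (hΓ H hm)
    simp [this]
  · simp only [Multiset.mem_add] at hm ⊢
    tauto

end Derivable
/-! ### Monotonicity in the extra costs -/

theorem rel_restrict {α : Type*} {r : α → α → Prop} {p : α → Prop} [DecidablePred p]
    {s t : Multiset α} (hp : ∀ x y, r x y → (p x ↔ p y)) (h : Multiset.Rel r s t) :
    Multiset.Rel r (s.filter p) (t.filter p) := by
  induction h with
  | zero => exact Multiset.Rel.zero
  | @cons a b as bs hab _ ih =>
    by_cases ha : p a
    · rw [Multiset.filter_cons_of_pos _ ha, Multiset.filter_cons_of_pos _ ((hp a b hab).1 ha)]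
      exact ih.cons hab
    · rw [Multiset.filter_cons_of_neg _ ha,
        Multiset.filter_cons_of_neg _ fun hb => ha ((hp a b hab).2 hb)]
      exact ih

theorem forall_isBang_of_rel {α K : Type*} [CommSemiring K] {Γ Δ : Multiset (Formula α K)}
    (h : Multiset.Rel Cheaper Γ Δ) (hΓ : ∀ G ∈ Γ, G.IsBang) : ∀ G ∈ Δ, G.IsBang := by
  intro G hG
  obtain ⟨F, hF, hFG⟩ := Multiset.exists_mem_of_rel_of_mem (Multiset.rel_flip.2 h) hG
  exact hFG.isBang_iff.1 (hΓ F hF)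

namespace Derivable

variable {α K : Type*} [CommSemiring K] {Γ Δ : Multiset (Formula α K)}
  {C C' : Formula α K} {a : K}

theorem of_cheaper (h : Derivable Mode.cutFree Γ a C) (hΓ : Multiset.Rel Cheaper Γ Δ)
    (hC : Cheaper C C') : Derivable Mode.cutFree Δ a C' := by
  classical
  induction h generalizing Δ C' with
  | init Γ p =>
    obtain ⟨_, Δ', hp, -, rfl⟩ := Multiset.rel_cons_left.1 hΓ
    cases hp
    cases hC
    exact .init Δ' p
  | oneR =>
    cases hC
    exact .oneR Δ
  | zeroL Γ C =>
    obtain ⟨_, Δ', hp, -, rfl⟩ := Multiset.rel_cons_left.1 hΓ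
    cases hp
    exact .zeroL Δ' C'
  | tensorL _ ih =>
    obtain ⟨_, Δ', hp, h', rfl⟩ := Multiset.rel_cons_left.1 hΓ
    cases hp with
    | tensor hA hB => exact .tensorL (ih ((h'.cons hB).cons hA) hC)
  | tensorR hb _ _ ih₁ ih₂ =>
    obtain ⟨_, Δ₂', h, h₂, rfl⟩ := Multiset.rel_add_left.1 hΓ
    obtain ⟨Γ', Δ₁', h₀, h₁, rfl⟩ := Multiset.rel_add_left.1 h
    cases hC with
    | tensor hA hB =>
      exact .tensorR (forall_isBang_of_rel h₀ hb) (ih₁ (h₀.add h₁) hA) (ih₂ (h₀.add h₂) hB)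
  | lolliL hb _ _ ih₁ ih₂ =>
    obtain ⟨_, Δ', hp, h', rfl⟩ := Multiset.rel_cons_left.1 hΓ
    obtain ⟨_, Δ₂', h, h₂, rfl⟩ := Multiset.rel_add_left.1 h'
    obtain ⟨Γ', Δ₁', h₀, h₁, rfl⟩ := Multiset.rel_add_left.1 h
    cases hp with
    | lolli hA hB =>
      exact .lolliL (forall_isBang_of_rel h₀ hb) (ih₁ (h₀.add h₁) hA)
        (ih₂ ((h₀.add h₂).cons hB) hC)
  | lolliR _ ih =>
    cases hC with
    | lolli hA hB => exact .lolliR (ih (hΓ.cons hA) hB)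
  | withL₁ _ ih =>
    obtain ⟨_, Δ', hp, h', rfl⟩ := Multiset.rel_cons_left.1 hΓ
    cases hp with
    | with_ hA hB => exact .withL₁ (ih (h'.cons hA) hC)
  | withL₂ _ ih =>
    obtain ⟨_, Δ', hp, h', rfl⟩ := Multiset.rel_cons_left.1 hΓ
    cases hp with
    | with_ hA hB => exact .withL₂ (ih (h'.cons hB) hC)
  | withR hg _ _ ih₁ ih₂ =>
    cases hC with
    | with_ hA hB => exact .withR hg (ih₁ hΓ hA) (ih₂ hΓ hB)
  | plusL hg _ _ ih₁ ih₂ =>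
    obtain ⟨_, Δ', hp, h', rfl⟩ := Multiset.rel_cons_left.1 hΓ
    cases hp with
    | plus hA hB => exact .plusL hg (ih₁ (h'.cons hA) hC) (ih₂ (h'.cons hB) hC)
  | plusR₁ _ ih =>
    cases hC with
    | plus hA hB => exact .plusR₁ (ih hΓ hA)
  | plusR₂ _ ih =>
    cases hC with
    | plus hA hB => exact .plusR₂ (ih hΓ hB)
  | bangL _ ih =>
    obtain ⟨_, Δ', hp, h', rfl⟩ := Multiset.rel_cons_left.1 hΓ
    cases hp with
    | bang hc hA =>
      -- Dereliction now has a cheaper price; label weakening restores the old one.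
      exact .weakenLabel (CostLE.mul _ (CostLE.mul _ hc))
        (.bangL (ih ((h'.cons (.bang hc hA)).cons hA) hC))
  | vbangL _ ih =>
    obtain ⟨_, Δ', hp, h', rfl⟩ := Multiset.rel_cons_left.1 hΓ
    cases hp with
    | vbang hA => exact .vbangL (ih (h'.cons hA) hC)
  | @bangR Γ e A b _ ih =>
    cases hC with
    | bang hc hA =>
      exact .bangR (ih (rel_restrict (fun _ _ h => h.belowBang_iff _) hΓ) hA)
  | vbangR _ ih =>
    cases hC with
    | vbang hA => exact .vbangR (ih (rel_restrict (fun _ _ h => h.belowVbang_iff _) hΓ) hA)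
  | weakenLabel hl _ ih => exact .weakenLabel hl (ih hΓ hC)
  | cut hm => cases hm

/-- Used whenever a cut is moved to a premise or a subformula whose label is cheaper than the one
the right proof was charged with. -/
theorem charge_mono [Absorptive K] {a b c : K} {F : Formula α K} (hab : CostLE a b)
    (h : Derivable Mode.cutFree (F.charge a ::ₘ Γ) c C) :
    Derivable Mode.cutFree (F.charge b ::ₘ Γ) c C :=
  h.of_cheaper (.cons (.charge hab F) (Multiset.rel_refl_of_refl_on fun G _ => .refl G)) (.refl C)

end Derivable

/-! ### Substitution of a context for a formula -/

/-- The context `Γ` can replace, at the additional cost `k`, the formula where it is introduced by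
a left rule. -/
def Replaces {α K : Type*} [CommSemiring K] (Γ : Multiset (Formula α K)) (k : K) :
    Formula α K → Prop
  | atom p => Derivable Mode.cutFree Γ k (atom p)
  | zero => ∀ Δ C, Derivable Mode.cutFree (Γ + Δ) k C
  | one => True
  | lolli A B => ∀ Δ₁ Δ₂ C a b, Derivable Mode.cutFree Δ₁ a A →
      Derivable Mode.cutFree (B ::ₘ Δ₂) b C →
      Derivable Mode.cutFree (Γ + Δ₁ + Δ₂) (k * (a * b)) C
  | tensor A B => ∀ Δ C b, Derivable Mode.cutFree (A ::ₘ B ::ₘ Δ) b C →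
      Derivable Mode.cutFree (Γ + Δ) (k * b) C
  | with_ A B => ∀ Δ C b, Derivable Mode.cutFree (A ::ₘ Δ) b C ∨
      Derivable Mode.cutFree (B ::ₘ Δ) b C → Derivable Mode.cutFree (Γ + Δ) (k * b) C
  | plus A B => ∀ Δ C b, Derivable Mode.cutFree (A ::ₘ Δ) b C →
      Derivable Mode.cutFree (B ::ₘ Δ) b C → Derivable Mode.cutFree (Γ + Δ) (k * b) C
  | bang e A => ∀ Δ C b, Derivable Mode.cutFree (A ::ₘ Δ) b C →
      Derivable Mode.cutFree (Γ + Δ) (b * e.price) C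
  | vbang e A => ∀ Δ C b, Derivable Mode.cutFree (A ::ₘ Δ) b C →
      Derivable Mode.cutFree (Γ + Δ) (k * (b * e.price)) C

theorem add_add_eq_cons {β : Type*} {s t u v : Multiset β} {x : β} (h : s + t + u = x ::ₘ v) :
    (∃ s', s = x ::ₘ s' ∧ v = s' + t + u) ∨ (∃ t', t = x ::ₘ t' ∧ v = s + t' + u) ∨
      ∃ u', u = x ::ₘ u' ∧ v = s + t + u' := by
  have hx : x ∈ s + t + u := h ▸ Multiset.mem_cons_self x v
  simp only [Multiset.mem_add] at hx
  rcases hx with (hx | hx) | hx <;> obtain ⟨w, rfl⟩ := Multiset.exists_cons_of_mem hx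
  · exact Or.inl ⟨w, rfl, by simpa [Multiset.cons_add] using h.symm⟩
  · exact Or.inr (Or.inl ⟨w, rfl, by simpa [Multiset.cons_add, Multiset.add_cons] using h.symm⟩)
  · exact Or.inr (Or.inr ⟨w, rfl, by simpa [Multiset.cons_add, Multiset.add_cons] using h.symm⟩)

namespace Derivable

variable {α K : Type*} [CommSemiring K] {Γ Δ Θ : Multiset (Formula α K)}
  {C G : Formula α K} {b k : K}

theorem cast {a b : K} (h : Derivable Mode.cutFree Γ a C) (hΓ : Γ = Δ) (hab : a = b) :
    Derivable Mode.cutFree Δ b C :=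
  hΓ ▸ hab ▸ h

/-- Induction on the proof containing `G`, with `Replaces` used where `G` is principal. A
multiplicative rule sends `G` to one premise, which pays `k`, unless `G` is a shared `!B`; then `Γ`
must be shareable and `k` must be `1`, since it would otherwise be paid repeatedly. The conditions
`hB` and `hV` make `Γ` survive every promotion that `G` survives. -/
theorem substitute [Absorptive K] (hG : Replaces Γ k G) (hbang : G.IsBang → k = 1 ∧ ∀ H ∈ Γ, H.IsBang)
    (hB : ∀ e, G.BelowBang e → ∀ H ∈ Γ, H.BelowBang e)
    (hV : ∀ e, G.BelowVbang e → ∀ H ∈ Γ, H.BelowVbang e)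
    (h : Derivable Mode.cutFree Θ b C) (hΘ : Θ = G ::ₘ Δ) :
    Derivable Mode.cutFree (Γ + Δ) (k * b) C := by
  classical
  induction h generalizing Δ with
  | init Θ p =>
    rcases Multiset.cons_eq_cons.1 hΘ with ⟨rfl, rfl⟩ | ⟨-, Δ', -, rfl⟩
    · exact (of_le hG (Multiset.le_add_right _ _)).cast rfl (mul_one k).symm
    · exact .weakenLabel (CostLE.one _) ((Derivable.init (Γ + Δ') p).cast (by simp) rfl)
  | oneR => exact .weakenLabel (CostLE.one _) (.oneR _)
  | zeroL Θ C =>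
    rcases Multiset.cons_eq_cons.1 hΘ with ⟨rfl, rfl⟩ | ⟨-, Δ', -, rfl⟩
    · exact (hG _ _).cast rfl (mul_one k).symm
    · exact .weakenLabel (CostLE.one _) ((Derivable.zeroL (Γ + Δ') C).cast (by simp) rfl)
  | @tensorL Θ A B C b h ih =>
    rcases Multiset.cons_eq_cons.1 hΘ with ⟨rfl, rfl⟩ | ⟨-, Δ', rfl, rfl⟩
    · exact hG _ _ _ h
    · refine (Derivable.tensorL ((ih (Δ := A ::ₘ B ::ₘ Δ') ?_).cast ?_ rfl)).cast
        (Multiset.add_cons _ _ _).symm rfl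
      all_goals simp only [← Multiset.singleton_add]; abel
  | @tensorR Γ₀ Δ₁ Δ₂ A B a b hb h₁ h₂ ih₁ ih₂ =>
    rcases add_add_eq_cons hΘ with ⟨Γ', rfl, rfl⟩ | ⟨Δ', rfl, rfl⟩ | ⟨Δ', rfl, rfl⟩
    · obtain ⟨rfl, hΓ⟩ := hbang (hb G (Multiset.mem_cons_self _ _))
      have hb' : ∀ H ∈ Γ + Γ', H.IsBang := fun H hH => by
        rcases Multiset.mem_add.1 hH with hH | hH
        · exact hΓ H hH
        · exact hb H (Multiset.mem_cons_of_mem hH)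
      refine (Derivable.tensorR hb' ((ih₁ (Δ := Γ' + Δ₁) (Multiset.cons_add _ _ _)).cast
        (add_assoc _ _ _).symm (one_mul _)) ((ih₂ (Δ := Γ' + Δ₂) (Multiset.cons_add _ _ _)).cast
        (add_assoc _ _ _).symm (one_mul _))).cast ?_ (one_mul _).symm
      abel
    · exact (Derivable.tensorR (Δ₁ := Γ + Δ') hb
        ((ih₁ (Δ := Γ₀ + Δ') (by simp)).cast (by abel) rfl) h₂).cast (by abel) (by ring)
    · exact (Derivable.tensorR (Δ₂ := Γ + Δ') hb h₁
        ((ih₂ (Δ := Γ₀ + Δ') (by simp)).cast (by abel) rfl)).cast (by abel) (by ring)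
  | @lolliL Γ₀ Δ₁ Δ₂ A B C a b hb h₁ h₂ ih₁ ih₂ =>
    rcases Multiset.cons_eq_cons.1 hΘ with ⟨rfl, rfl⟩ | ⟨-, Θ', hΘ', rfl⟩
    -- Both premises contain `Γ₀`, so replacing the implication yields it twice.
    · exact (contract (Δ := Γ + Δ₁ + Δ₂) hb
        ((hG _ _ _ _ _ h₁ h₂).cast (by abel) rfl)).cast (by abel) rfl
    · rcases add_add_eq_cons hΘ' with ⟨Γ', rfl, rfl⟩ | ⟨Δ', rfl, rfl⟩ | ⟨Δ', rfl, rfl⟩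
      · obtain ⟨rfl, hΓ⟩ := hbang (hb G (Multiset.mem_cons_self _ _))
        have hb' : ∀ H ∈ Γ + Γ', H.IsBang := fun H hH => by
          rcases Multiset.mem_add.1 hH with hH | hH
          · exact hΓ H hH
          · exact hb H (Multiset.mem_cons_of_mem hH)
        refine (Derivable.lolliL (A := A) (B := B) (Δ₂ := Δ₂) hb'
          ((ih₁ (Δ := Γ' + Δ₁) (Multiset.cons_add _ _ _)).cast (add_assoc _ _ _).symm (one_mul _))
          ((ih₂ (Δ := B ::ₘ (Γ' + Δ₂)) ?_).cast ?_ (one_mul _))).cast ?_ (one_mul _).symm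
        all_goals simp only [← Multiset.singleton_add]; abel
      · refine (Derivable.lolliL (Δ₁ := Γ + Δ') hb
          ((ih₁ (Δ := Γ₀ + Δ') (by simp)).cast (by abel) rfl) h₂).cast ?_ (by ring)
        simp only [← Multiset.singleton_add]; abel
      · refine (Derivable.lolliL (A := A) (B := B) (Δ₂ := Γ + Δ') hb h₁
          ((ih₂ (Δ := B ::ₘ (Γ₀ + Δ')) ?_).cast ?_ rfl)).cast ?_ (by ring)
        all_goals simp only [← Multiset.singleton_add]; abel
  | lolliR h ih =>
    subst hΘ
    exact .lolliR ((ih (Multiset.cons_swap _ _ _)).cast (Multiset.add_cons _ _ _) rfl)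
  | withL₁ h ih =>
    rcases Multiset.cons_eq_cons.1 hΘ with ⟨rfl, rfl⟩ | ⟨-, Δ', rfl, rfl⟩
    · exact hG _ _ _ (Or.inl h)
    · exact (Derivable.withL₁ ((ih (Multiset.cons_swap _ _ _)).cast
        (Multiset.add_cons _ _ _) rfl)).cast (Multiset.add_cons _ _ _).symm rfl
  | withL₂ h ih =>
    rcases Multiset.cons_eq_cons.1 hΘ with ⟨rfl, rfl⟩ | ⟨-, Δ', rfl, rfl⟩
    · exact hG _ _ _ (Or.inr h)
    · exact (Derivable.withL₂ ((ih (Multiset.cons_swap _ _ _)).cast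
        (Multiset.add_cons _ _ _) rfl)).cast (Multiset.add_cons _ _ _).symm rfl
  | withR hg h₁ h₂ ih₁ ih₂ =>
    -- Multiplication by `k` is not assumed to preserve greatest lower bounds; instead both premises
    -- are weakened to the label of the conclusion.
    exact .withR (IsCostGlb.self _) (.weakenLabel (CostLE.mul k hg.1) (ih₁ hΘ))
      (.weakenLabel (CostLE.mul k hg.2.1) (ih₂ hΘ))
  | plusL hg h₁ h₂ ih₁ ih₂ =>
    rcases Multiset.cons_eq_cons.1 hΘ with ⟨rfl, rfl⟩ | ⟨-, Δ', rfl, rfl⟩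
    · exact hG _ _ _ (.weakenLabel hg.1 h₁) (.weakenLabel hg.2.1 h₂)
    · exact (Derivable.plusL (IsCostGlb.self _)
        (.weakenLabel (CostLE.mul k hg.1) ((ih₁ (Multiset.cons_swap _ _ _)).cast
          (Multiset.add_cons _ _ _) rfl))
        (.weakenLabel (CostLE.mul k hg.2.1) ((ih₂ (Multiset.cons_swap _ _ _)).cast
          (Multiset.add_cons _ _ _) rfl))).cast (Multiset.add_cons _ _ _).symm rfl
  | plusR₁ _ ih => exact .plusR₁ (ih hΘ)
  | plusR₂ _ ih => exact .plusR₂ (ih hΘ)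
  | @bangL Θ e A C c h ih =>
    rcases Multiset.cons_eq_cons.1 hΘ with ⟨rfl, rfl⟩ | ⟨-, Δ', rfl, rfl⟩
    · obtain ⟨rfl, hΓ⟩ := hbang ⟨_, _, rfl⟩
      -- The induction hypothesis replaces the copy of `G` kept in the premise, and `hG` replaces
      -- the derelicted one; the two copies of `Γ` are then contracted.
      refine (contract hΓ (hG _ _ _ ((ih (Multiset.cons_swap _ _ _)).cast
        (Multiset.add_cons _ _ _) (one_mul _)))).cast rfl (one_mul _).symm
    · refine (Derivable.bangL ((ih (Δ := A ::ₘ bang e A ::ₘ Δ') ?_).cast ?_ rfl)).cast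
        (Multiset.add_cons _ _ _).symm (by ring)
      all_goals simp only [← Multiset.singleton_add]; abel
  | vbangL h ih =>
    rcases Multiset.cons_eq_cons.1 hΘ with ⟨rfl, rfl⟩ | ⟨-, Δ', rfl, rfl⟩
    · exact hG _ _ _ h
    · exact (Derivable.vbangL ((ih (Multiset.cons_swap _ _ _)).cast
        (Multiset.add_cons _ _ _) rfl)).cast (Multiset.add_cons _ _ _).symm (by ring)
  | @bangR Θ e A b h ih =>
    subst hΘ
    refine .bangR ?_
    by_cases he : G.BelowBang e
    · refine (ih (Multiset.filter_cons_of_pos _ he)).cast ?_ rfl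
      rw [restrictBang, Multiset.filter_add, Multiset.filter_eq_self.2 (hB e he)]
    -- Here promotion discards `G`, so the premise never used it: `Γ` is added by weakening and `k`
    -- by label weakening.
    · rw [restrictBang, Multiset.filter_cons_of_neg _ he] at h
      refine .weakenLabel (CostLE.mul_right _ _) (h.of_le ?_)
      exact Multiset.filter_le_filter _ (Multiset.le_add_left _ _)
  | @vbangR Θ e A b h ih =>
    subst hΘ
    refine .vbangR ?_
    by_cases he : G.BelowVbang e
    · refine (ih (Multiset.filter_cons_of_pos _ he)).cast ?_ rfl
      rw [restrictVbang, Multiset.filter_add, Multiset.filter_eq_self.2 (hV e he)]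
    · rw [restrictVbang, Multiset.filter_cons_of_neg _ he] at h
      refine .weakenLabel (CostLE.mul_right _ _) (h.of_le ?_)
      exact Multiset.filter_le_filter _ (Multiset.le_add_left _ _)
  | weakenLabel hl _ ih => exact .weakenLabel (CostLE.mul k hl) (ih hΘ)
  | cut hm => cases hm

/-- Substitution for a formula that does not survive any promotion. -/
theorem substitute_of_not_modal [Absorptive K] (hG : Replaces Γ k G)
    (hn : ∀ e B, G ≠ bang e B ∧ G ≠ vbang e B)
    (h : Derivable Mode.cutFree (G ::ₘ Δ) b C) : Derivable Mode.cutFree (Γ + Δ) (k * b) C := by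
  refine substitute hG ?_ ?_ ?_ h rfl
  · rintro ⟨e, B, rfl⟩
    exact absurd rfl (hn e B).1
  · rintro _ ⟨e, B, -, rfl⟩
    exact absurd rfl (hn e B).1
  · rintro _ ⟨e, B, -, rfl | rfl⟩
    · exact absurd rfl (hn e B).1
    · exact absurd rfl (hn e B).2

end Derivable
/-! ### Cut -/

/-- Cuts on `F` without shared contexts are admissible. -/
def CutAdmissible {α K : Type*} [CommSemiring K] (F : Formula α K) : Prop :=
  F.LolliLinear → ∀ (Γ Δ : Multiset (Formula α K)) (C : Formula α K) (a b : K),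
    Derivable Mode.cutFree Γ a F → Derivable Mode.cutFree (F.charge a ::ₘ Δ) b C →
    Derivable Mode.cutFree (Γ + Δ) (a * b) C

namespace Derivable

variable {α K : Type*} [CommSemiring K] [Absorptive K] {Γ Δ : Multiset (Formula α K)}
  {F C : Formula α K} {a b : K}

/-- Induction on the left proof: left rules and label weakening permute with the cut, right rules
and the remaining axioms turn the left context into a replacement for the charged cut formula. The
label in the charge varies with the induction. -/
theorem cut_of_smaller (h : Derivable Mode.cutFree Γ a F) (hF : F.LolliLinear)
    (hcut : ∀ F' : Formula α K, sizeOf F' < sizeOf F → CutAdmissible F')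
    (hr : Derivable Mode.cutFree (F.charge a ::ₘ Δ) b C) :
    Derivable Mode.cutFree (Γ + Δ) (a * b) C := by
  classical
  induction h with
  | init Γ p => exact substitute_of_not_modal (G := atom p) (Derivable.init Γ p) (by simp) hr
  | oneR => exact substitute_of_not_modal (G := one) trivial (by simp) hr
  | zeroL Γ F =>
    exact .weakenLabel (CostLE.one _)
      ((Derivable.zeroL (Γ + Δ) C).cast (Multiset.cons_add _ _ _).symm rfl)
  | tensorL _ ih =>
    exact (Derivable.tensorL ((ih hF hcut hr).cast (by simp) rfl)).cast
      (Multiset.cons_add _ _ _).symm rfl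
  | @tensorR Γ Δ₁ Δ₂ A B a₁ a₂ hb h₁ h₂ _ _ =>
    have cutA := hcut A (by simp; omega) (hF.mono fun x hx => by simp [subformulas, hx])
    have cutB := hcut B (by simp) (hF.mono fun x hx => by simp [subformulas, hx])
    refine substitute_of_not_modal (fun Δ C c h => ?_) (by simp [charge]) hr
    have h := (cutA _ _ _ _ _ h₁ (h.charge_mono (CostLE.mul_left a₁ a₂))).cast
      (Multiset.add_cons _ _ _) rfl
    have h := cutB _ _ _ _ _ h₂ (h.charge_mono (CostLE.mul_right a₁ a₂))
    refine (contract (Δ := Δ₁ + Δ₂ + Δ) hb (h.cast ?_ (by ring))).cast ?_ rfl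
    all_goals abel
  | @lolliL Γ Δ₁ Δ₂ A B F a₁ a₂ hb h₁ h₂ _ ih =>
    have h := ih hF hcut (hr.charge_mono (CostLE.mul_right a₁ a₂))
    refine (Derivable.lolliL (A := A) (B := B) (Δ₂ := Δ₂ + Δ) hb h₁ (h.cast ?_ rfl)).cast ?_
      (mul_assoc _ _ _).symm
    all_goals simp only [← Multiset.singleton_add]; abel
  | @lolliR Γ A B a h₁ _ =>
    have hA : A.BangFree := hF A B (mem_subformulas_self _)
    have cutA := hcut A (by simp; omega) (hF.mono fun x hx => by simp [subformulas, hx])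
    have cutB := hcut B (by simp) (hF.mono fun x hx => by simp [subformulas, hx])
    refine substitute_of_not_modal (fun Δ₁ Δ₂ C b₁ b₂ hl h => ?_) (by simp [charge]) hr
    -- Bang-freeness serves twice: here the argument supplied by the right proof becomes a proof of
    -- the uncharged `A`, and below the antecedent `A` of the left proof counts as charged with
    -- `b₁`.
    rw [hA.charge_eq] at hl
    have h := cutB _ _ _ _ _ h₁ h
    have h := cutA Δ₁ (Γ + Δ₂) _ _ _ hl (h.cast
      (by rw [hA.charge_eq, Multiset.cons_add]) rfl)
    exact h.cast (by abel) (by ring)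
  | withL₁ _ ih =>
    exact (Derivable.withL₁ ((ih hF hcut hr).cast (by simp) rfl)).cast
      (Multiset.cons_add _ _ _).symm rfl
  | withL₂ _ ih =>
    exact (Derivable.withL₂ ((ih hF hcut hr).cast (by simp) rfl)).cast
      (Multiset.cons_add _ _ _).symm rfl
  | @withR Γ A B a₁ a₂ a hg h₁ h₂ _ _ =>
    have cutA := hcut A (by simp; omega) (hF.mono fun x hx => by simp [subformulas, hx])
    have cutB := hcut B (by simp) (hF.mono fun x hx => by simp [subformulas, hx])
    refine substitute_of_not_modal (fun Δ C c h => ?_) (by simp [charge]) hr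
    rcases h with h | h
    · exact cutA _ _ _ _ _ (.weakenLabel hg.1 h₁) h
    · exact cutB _ _ _ _ _ (.weakenLabel hg.2.1 h₂) h
  | plusL hg _ _ ih₁ ih₂ =>
    have h₁ := ih₁ hF hcut (hr.charge_mono hg.1)
    have h₂ := ih₂ hF hcut (hr.charge_mono hg.2.1)
    rw [Multiset.cons_add] at h₁ h₂ ⊢
    rw [mul_comm] at h₁ h₂ ⊢
    exact .plusL (IsCostGlb.self _) (.weakenLabel (CostLE.mul _ hg.1) h₁)
      (.weakenLabel (CostLE.mul _ hg.2.1) h₂)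
  | @plusR₁ Γ A B a h₁ _ =>
    have cutA := hcut A (by simp; omega) (hF.mono fun x hx => by simp [subformulas, hx])
    refine substitute_of_not_modal (fun Δ C c h _ => ?_) (by simp [charge]) hr
    exact cutA _ _ _ _ _ h₁ h
  | @plusR₂ Γ A B a h₁ _ =>
    have cutB := hcut B (by simp) (hF.mono fun x hx => by simp [subformulas, hx])
    refine substitute_of_not_modal (fun Δ C c _ h => ?_) (by simp [charge]) hr
    exact cutB _ _ _ _ _ h₁ h
  | @bangL Γ e A F c _ ih =>
    have h := ih hF hcut (hr.charge_mono (CostLE.mul_left c e.price))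
    exact (Derivable.bangL (h.cast (by simp) rfl)).cast
      (Multiset.cons_add _ _ _).symm (by ring)
  | @vbangL Γ e A F c _ ih =>
    have h := ih hF hcut (hr.charge_mono (CostLE.mul_left c e.price))
    exact (Derivable.vbangL (h.cast (by simp) rfl)).cast
      (Multiset.cons_add _ _ _).symm (by ring)
  | @bangR Γ e A a h₁ _ =>
    have cutA := hcut A (by simp) (hF.mono fun x hx => by simp [subformulas, hx])
    have hmem : ∀ H ∈ restrictBang e Γ, H.BelowBang e := fun H hH => (Multiset.mem_filter.1 hH).2
    -- The factor is `1` although the left label is `a`: the charged label `e` has price `e.base *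
    -- (e.extra * a)`, so each dereliction already pays for a cut on `A` at cost `a`.
    have h : Derivable Mode.cutFree (restrictBang e Γ + Δ) (1 * b) C := by
      refine substitute (fun Δ C c h => ?_) (fun _ => ⟨rfl, fun H hH => (hmem H hH).isBang⟩)
        ?_ ?_ hr rfl
      · refine .weakenLabel ?_ (cutA _ _ _ _ _ h₁ h)
        have := CostLE.mul_left (a * c) (e.base * e.extra)
        convert this using 1
        simp only [ModalLabel.price]
        ring
      · rintro e' ⟨f, B, hle, heq⟩ H hH
        cases heq
        exact (hmem H hH).trans hle
      · rintro e' ⟨f, B, hle, heq | heq⟩ H hH <;> cases heq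
        exact ((hmem H hH).trans (f := e) hle).belowVbang
    rw [one_mul] at h
    exact .weakenLabel (CostLE.mul_right _ _)
      (h.of_le (Multiset.add_le_add_right (Multiset.filter_le _ _)))
  | @vbangR Γ e A a h₁ _ =>
    have cutA := hcut A (by simp) (hF.mono fun x hx => by simp [subformulas, hx])
    have hmem : ∀ H ∈ restrictVbang e Γ, H.BelowVbang e :=
      fun H hH => (Multiset.mem_filter.1 hH).2
    -- The label of a single-use modality is not charged, but it is derelicted at most once on a
    -- branch, so `a` is paid as an outer factor.
    have h : Derivable Mode.cutFree (restrictVbang e Γ + Δ) (a * b) C := by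
      refine substitute (fun Δ C c h => ?_) (by simp [charge, IsBang]) ?_ ?_ hr rfl
      · refine .weakenLabel ?_ (cutA _ _ _ _ _ h₁ h)
        rw [← mul_assoc]
        exact CostLE.mul_left _ _
      · simp [charge, BelowBang]
      · rintro e' ⟨f, B, hle, heq | heq⟩ H hH <;> cases heq
        exact (hmem H hH).trans hle
    exact h.of_le (Multiset.add_le_add_right (Multiset.filter_le _ _))
  | weakenLabel hl _ ih =>
    have h := ih hF hcut (hr.charge_mono hl)
    rw [mul_comm] at h ⊢
    exact .weakenLabel (CostLE.mul _ hl) h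
  | cut hm => cases hm

end Derivable

/-! ### Admissibility for all formulas and elimination of cuts -/

theorem cutAdmissible {α K : Type*} [CommSemiring K] [Absorptive K] (F : Formula α K) :
    CutAdmissible F := by
  induction hn : sizeOf F using Nat.strong_induction_on generalizing F with
  | _ n ih =>
    subst hn
    exact fun hF Γ Δ C a b h hr => h.cut_of_smaller hF (fun F' hF' => ih _ hF' F' rfl) hr

theorem Derivable.cut_shared {α K : Type*} [CommSemiring K] [Absorptive K]
    {Γ Δ₁ Δ₂ : Multiset (Formula α K)} {F C : Formula α K} {a b : K} (hF : F.LolliLinear)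
    (hΓ : ∀ G ∈ Γ, G.IsBang) (h₁ : Derivable Mode.cutFree (Γ + Δ₁) a F)
    (h₂ : Derivable Mode.cutFree (F.charge a ::ₘ (Γ + Δ₂)) b C) :
    Derivable Mode.cutFree (Γ + Δ₁ + Δ₂) (a * b) C :=
  (Derivable.contract (Δ := Δ₁ + Δ₂) hΓ
    ((cutAdmissible F hF _ _ _ _ _ h₁ h₂).cast (by abel) rfl)).cast (add_assoc _ _ _).symm rfl

/-- Each cut is replaced once its premises are cut-free. Admissibility gives exactly the label of
the cut rule, so no label has to be adjusted further down. -/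
theorem Derivable.eliminate_cut {α K : Type*} [CommSemiring K] [Absorptive K]
    {Γ : Multiset (Formula α K)} {C : Formula α K} {a : K}
    (h : Derivable Mode.withCut Γ a C) : Derivable Mode.cutFree Γ a C := by
  induction h with
  | init Γ p => exact .init Γ p
  | oneR Γ => exact .oneR Γ
  | zeroL Γ C => exact .zeroL Γ C
  | tensorL _ ih => exact .tensorL ih
  | tensorR hb _ _ ih₁ ih₂ => exact .tensorR hb ih₁ ih₂
  | lolliL hb _ _ ih₁ ih₂ => exact .lolliL hb ih₁ ih₂
  | lolliR _ ih => exact .lolliR ih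
  | withL₁ _ ih => exact .withL₁ ih
  | withL₂ _ ih => exact .withL₂ ih
  | withR hg _ _ ih₁ ih₂ => exact .withR hg ih₁ ih₂
  | plusL hg _ _ ih₁ ih₂ => exact .plusL hg ih₁ ih₂
  | plusR₁ _ ih => exact .plusR₁ ih
  | plusR₂ _ ih => exact .plusR₂ ih
  | bangL _ ih => exact .bangL ih
  | vbangL _ ih => exact .vbangL ih
  | bangR _ ih => exact .bangR ih
  | vbangR _ ih => exact .vbangR ih
  | weakenLabel hl _ ih => exact .weakenLabel hl ih
  | cut _ hF hΓ _ _ ih₁ ih₂ => exact .cut_shared hF hΓ ih₁ ih₂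

end LaSELL

open LaSELL in
theorem mainTheorem9 {α K : Type*} [CommSemiring K] [LaSELL.Absorptive K] [LaSELL.Invertible K] :
    (∀ (Γ Δ₁ Δ₂ : Multiset (Formula α K)) (F C : Formula α K) (a b : K),
      F.LolliLinear → (∀ G ∈ Γ, G.IsBang) →
      Derivable Mode.cutFree (Γ + Δ₁) a F →
      Derivable Mode.cutFree (F.charge a ::ₘ (Γ + Δ₂)) b C →
      Derivable Mode.cutFree (Γ + Δ₁ + Δ₂) (a * b) C) ∧
    (∀ (Γ : Multiset (Formula α K)) (C : Formula α K) (a : K),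
      Derivable Mode.withCut Γ a C →
      ∃ a' : K, CostLE a a' ∧ Derivable Mode.cutFree Γ a' C) :=
  ⟨fun _ _ _ _ _ _ _ hF hΓ h₁ h₂ => .cut_shared hF hΓ h₁ h₂,
    fun _ _ a h => ⟨a, CostLE.refl a, h.eliminate_cut⟩⟩
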